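/- Let $n\ge 2$ be an integer, $R>0$, $c\in C^1([0,R],[0,\infty))$, $f\in C^1([0,R])$, and let $\phi(R)\in\mathbb R$ be a constant. Assume that $c$ is coercive, i.e. there is $\delta>0$ such that, with $C_0=-\tfrac1R$ and $K_0=R$ (the constants of the ball $B(0,R)\subset\mathbb R^n$) and $q=1$, $$\frac{1}{n-1}c(r)^2-|c'(r)|-\delta>\max\Big\{0,\ C_0|c(r)|+\frac{(n-1)C_0}{K_0}+(1+q)\,\mathrm{sgn}(C_0)\,C_0^2\Big\}\qquad\text{for all } r\in[0,R].$$ Then there is at most one $r\in(0,R]$ with $c(r)=\frac{n-1}{r}$; call it $r_{cr}$ if it exists, and let $r_{cr}=\infty$ otherwise. Put $$P(r)=-f(r)+\mathbf 1_{\{r=R\}}\,\phi(R)\Big(\frac{n-1}{R}+\mathrm{sgn}(\phi(R))\,c(R)\Big),\qquad \lambda=\sup\{P(r):\ r\in[0,R],\ r\ge r_{cr}\text{ or } r=R\}.$$ Let $\widetilde{\mathcal A}=\{r\in[0,R]:\ r\ge r_{cr},\ P(r)=\lambda\}$ if $r_{cr}<\infty$, and $\widetilde{\mathcal A}=\{R\}$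 if $r_{cr}=\infty$. Then $\widetilde{\mathcal A}$ has a minimum $r_0$ and a maximum $M$. Let $w^1,w^2:[0,R]\to\mathbb R$ be two viscosity solutions of the stationary problem $$\lambda-\frac{n-1}{r}w_r-c(r)|w_r|+f(r)=0\ \text{ in }(0,R),\qquad w_r(R)=\phi(R),$$ where the boundary condition is also understood in the viscosity sense. That is, each $w=w^i$ is continuous on $[0,R]$ and, with $G(r,p)=\lambda-\frac{n-1}{r}p-c(r)|p|+f(r)$, for every $\psi\in C^1$: if $w-\psi$ has a local maximum relative to $[0,R]$ at $\hat r$, then $G(\hat r,\psi'(\hat r))\le 0$ when $\hat r\in(0,R)$, and $\min\{G(R,\psi'(R)),\psi'(R)-\phi(R)\}\le 0$ when $\hat r=R$; if $w-\psi$ has a local minimum relative to $[0,R]$ at $\hat r$, then $G(\hat r,\psi'(\hat r))\ge 0$ when $\hat r\in(0,R)$, and $\max\{G(R,\psi'(R)),\psi'(R)-\phi(R)\}\ge 0$ when $\hat r=R$. If $w^1(r_0)=w^2(r_0)$ and $w^1(M)=w^2(M)$, then $w^1=w^2$ on $[r_{cr},r_0]\cup[M,R]$ (where $[r_{cr},r_0]=\emptyset$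 if $r_{cr}=\infty$). -/

import Mathlib

open Set

noncomputable section

namespace RadialLevelSet

/-- The coercivity condition on the force, for a domain whose boundary has constants `C₀` (largest
eigenvalue of minus the curvature matrix) and `K₀` (interior ball radius), a boundary exponent `q`,
and a radial force `c`, `|Dc(x)| = |c'(r)|` for `|x| = r ∈ [0, R]`. -/
def CoerciveWith (n : ℕ) (R C₀ K₀ q : ℝ) (c : ℝ → ℝ) : Prop :=
  ∃ δ : ℝ, 0 < δ ∧ ∀ r ∈ Icc (0 : ℝ) R,
    max 0 (C₀ * |c r| + ((n : ℝ) - 1) * C₀ / K₀ + (1 + q) * Real.sign C₀ * C₀ ^ 2)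
      < 1 / ((n : ℝ) - 1) * c r ^ 2 - |derivWithin c (Icc 0 R) r| - δ

/-- Coercivity on the ball `B(0, R)` with the Neumann condition (`q = 1`): all principal
curvatures of the sphere are `1 / R`, so `C₀ = -1 / R`, and the interior ball radius is `R`. -/
def Coercive (n : ℕ) (R : ℝ) (c : ℝ → ℝ) : Prop :=
  CoerciveWith n R (-1 / R) R 1 c

/-- The radii in `(0, R]` at which the curves `c(r)` and `(n - 1) / r` meet. -/
def crossingSet (n : ℕ) (R : ℝ) (c : ℝ → ℝ) : Set ℝ :=
  {r | r ∈ Ioc 0 R ∧ c r = ((n : ℝ) - 1) / r}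

/-- The critical radius: the crossing radius (unique for coercive `c`, see `critRadius_eq`),
and `⊤ = ∞` if the curves do not meet (the infimum of the empty set in `EReal` is `⊤`). -/
def critRadius (n : ℕ) (R : ℝ) (c : ℝ → ℝ) : EReal :=
  sInf ((fun r : ℝ => (r : EReal)) '' crossingSet n R c)

/-- `-f(r) + δ(r - R) φ(R) ((n - 1) / R + sgn(φ(R)) c(R))`, where `δ` is `1` at the origin and `0`
elsewhere, and `φR` is the constant `φ(R)`. -/
def payoff (n : ℕ) (R : ℝ) (c f : ℝ → ℝ) (φR r : ℝ) : ℝ :=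
  -f r + (if r = R then φR * (((n : ℝ) - 1) / R + Real.sign φR * c R) else 0)

/-- The eigenvalue: the supremum of the payoff over `r ∈ [0, R]` with `r ≥ r_cr` or `r = R`. -/
def eigenvalue (n : ℕ) (R : ℝ) (c f : ℝ → ℝ) (φR : ℝ) : ℝ :=
  sSup (payoff n R c f φR '' {r | r ∈ Icc 0 R ∧ (critRadius n R c ≤ (r : EReal) ∨ r = R)})

/-- The Aubry set: the radii `r ≥ r_cr` in `[0, R]` at which the supremum defining the eigenvalue
is attained, if `r_cr < ∞`, and `{R}` if `r_cr = ∞`. -/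
def aubrySet (n : ℕ) (R : ℝ) (c f : ℝ → ℝ) (φR : ℝ) : Set ℝ :=
  if critRadius n R c = ⊤ then {R}
  else {r | r ∈ Icc 0 R ∧ critRadius n R c ≤ (r : EReal) ∧
    payoff n R c f φR r = eigenvalue n R c f φR}

/-- The left-hand side `lam - ((n - 1) / r) p - c(r) |p| + f(r)` of the stationary equation. -/
def stationaryOp (n : ℕ) (c f : ℝ → ℝ) (lam r p : ℝ) : ℝ :=
  lam - ((n : ℝ) - 1) / r * p - c r * |p| + f r

/-- Viscosity subsolutions on `[0, R]` of the stationary equation in `(0, R)` with the Neumann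
condition `w_r(R) = φ(R)`, which is also understood in the viscosity sense. -/
def IsViscositySubsolution (n : ℕ) (R : ℝ) (c f : ℝ → ℝ) (φR lam : ℝ) (w : ℝ → ℝ) : Prop :=
  UpperSemicontinuousOn w (Icc 0 R) ∧
  ∀ ψ : ℝ → ℝ, ContDiff ℝ 1 ψ →
    (∀ r ∈ Ioo 0 R, IsLocalMaxOn (fun s => w s - ψ s) (Icc 0 R) r →
      stationaryOp n c f lam r (deriv ψ r) ≤ 0) ∧
    (IsLocalMaxOn (fun s => w s - ψ s) (Icc 0 R) R →
      min (stationaryOp n c f lam R (deriv ψ R)) (deriv ψ R - φR) ≤ 0)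

/-- Viscosity supersolutions of the same problem. -/
def IsViscositySupersolution (n : ℕ) (R : ℝ) (c f : ℝ → ℝ) (φR lam : ℝ) (w : ℝ → ℝ) : Prop :=
  LowerSemicontinuousOn w (Icc 0 R) ∧
  ∀ ψ : ℝ → ℝ, ContDiff ℝ 1 ψ →
    (∀ r ∈ Ioo 0 R, IsLocalMinOn (fun s => w s - ψ s) (Icc 0 R) r →
      0 ≤ stationaryOp n c f lam r (deriv ψ r)) ∧
    (IsLocalMinOn (fun s => w s - ψ s) (Icc 0 R) R →
      0 ≤ max (stationaryOp n c f lam R (deriv ψ R)) (deriv ψ R - φR))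

/-- Viscosity solutions of the stationary problem. -/
def IsViscositySolution (n : ℕ) (R : ℝ) (c f : ℝ → ℝ) (φR lam : ℝ) (w : ℝ → ℝ) : Prop :=
  IsViscositySubsolution n R c f φR lam w ∧ IsViscositySupersolution n R c f φR lam w

/-- For a coercive force the curves `c(r)` and `(n - 1) / r` meet at most once. -/
theorem crossingSet_subsingleton {n : ℕ} (hn : 2 ≤ n) {R : ℝ} {c : ℝ → ℝ}
    (hc : ContDiffOn ℝ 1 c (Icc 0 R)) (hc0 : ∀ r ∈ Icc (0 : ℝ) R, 0 ≤ c r)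
    (hco : Coercive n R c) : (crossingSet n R c).Subsingleton := by
  obtain ⟨δ, hδ, H⟩ := hco
  have hn1 : (0 : ℝ) < (n : ℝ) - 1 := by
    have : (2 : ℝ) ≤ n := by exact_mod_cast hn
    linarith
  have key : ∀ r ∈ Icc (0 : ℝ) R,
      ((n : ℝ) - 1) * |derivWithin c (Icc 0 R) r| < c r ^ 2 := by
    intro r hr
    have h := (le_max_left _ _).trans_lt (H r hr)
    have h2 : |derivWithin c (Icc 0 R) r| < 1 / ((n : ℝ) - 1) * c r ^ 2 := by linarith
    calc ((n : ℝ) - 1) * |derivWithin c (Icc 0 R) r|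
        < ((n : ℝ) - 1) * (1 / ((n : ℝ) - 1) * c r ^ 2) := by gcongr
      _ = c r ^ 2 := by field_simp
  have hpos : ∀ r ∈ Icc (0 : ℝ) R, 0 < c r := by
    intro r hr
    have h := key r hr
    have h3 : 0 < c r ^ 2 := lt_of_le_of_lt (by positivity) h
    rcases (hc0 r hr).lt_or_eq with h4 | h4
    · exact h4
    · rw [← h4] at h3; simp at h3
  have hanti : StrictAntiOn (fun r => ((n : ℝ) - 1) / c r - r) (Icc 0 R) := by
    apply strictAntiOn_of_deriv_neg (convex_Icc 0 R)
    · exact (continuousOn_const.div hc.continuousOn fun r hr => (hpos r hr).ne').sub continuousOn_id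
    · intro r hr
      rw [interior_Icc] at hr
      have hr' : r ∈ Icc (0 : ℝ) R := Ioo_subset_Icc_self hr
      have hnhds : Icc (0 : ℝ) R ∈ nhds r := Icc_mem_nhds hr.1 hr.2
      have hd : HasDerivAt c (derivWithin c (Icc 0 R) r) r :=
        ((hc.differentiableOn (by norm_num) r hr').hasDerivWithinAt).hasDerivAt hnhds
      have hd2 := ((hasDerivAt_const r ((n : ℝ) - 1)).div hd (hpos r hr').ne').sub (hasDerivAt_id r)
      have hd3 : deriv (fun r => ((n : ℝ) - 1) / c r - r) r = _ := hd2.deriv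
      rw [hd3]
      have hp := hpos r hr'
      rw [sub_neg, div_lt_one (by positivity)]
      have := key r hr'
      have h5 := neg_abs_le (derivWithin c (Icc 0 R) r)
      nlinarith
  rintro a ⟨ha, ha'⟩ b ⟨hb, hb'⟩
  have hz : ∀ r : ℝ, r ∈ Ioc (0 : ℝ) R → c r = ((n : ℝ) - 1) / r →
      ((n : ℝ) - 1) / c r - r = 0 := by
    intro r hr h
    have := hr.1
    rw [h]; field_simp; simp
  exact hanti.injOn (Ioc_subset_Icc_self ha) (Ioc_subset_Icc_self hb)
    ((hz a ha ha').trans (hz b hb hb').symm)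

/-- For a coercive force, `critRadius` is the crossing radius if there is one. -/
theorem critRadius_eq {n : ℕ} (hn : 2 ≤ n) {R : ℝ} {c : ℝ → ℝ}
    (hc : ContDiffOn ℝ 1 c (Icc 0 R)) (hc0 : ∀ r ∈ Icc (0 : ℝ) R, 0 ≤ c r)
    (hco : Coercive n R c) {r : ℝ} (hr : r ∈ crossingSet n R c) :
    critRadius n R c = (r : EReal) := by
  have h : crossingSet n R c = {r} :=
    (crossingSet_subsingleton hn hc hc0 hco).eq_singleton_of_mem hr
  simp [critRadius, h]

end RadialLevelSet

end

noncomputable section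

namespace RadialLevelSet

/-! Let `a` be the crossing radius; without one the set in question reduces to `{R}`. For `r > a`
one has `c r > (n - 1) / r`, so `p ↦ stationaryOp n c f lam r p` is a concave tent with roots
`slopeUp` and `-slopeDown`. Since the payoff dominates `-f`, `lam + f > 0` on `[a, R]` off the Aubry
set, and there the tent is positive strictly between its roots. Being a supersolution confines the
slopes of `w` to the interval between the roots; being a subsolution forbids testing with slopes
strictly inside it. Hence, as `r` grows, `w` may turn from slope `-slopeDown` to slope `slopeUp`,
but never back.

On `(a, r₀)`, a slope below `slopeUp` would force slope `-slopeDown` all the way back to `a`. The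
denominator of `slopeDown` vanishes at most linearly at `a`, so its integral diverges, against the
boundedness of `w`; thus `w' = slopeUp` (`integral_slopeUp_le`). On `(M, R)`, a slope above
`-slopeDown` would force slope `slopeUp` up to `R`. But `R` is then outside the Aubry set, which
gives `φR < slopeUp` at `R`, against the Neumann condition; thus `w' = -slopeDown`
(`sub_le_neg_integral_slopeDown`). The increments of `w` are therefore prescribed, and one value on
each interval determines it.

No differentiability of `w` is used: its increments are compared with integrals of continuous test
slopes `q`, and a mismatch creates a local extremum at which `q` is tested. -/

/-- The nonnegative root `p` of the stationary equation at `r`. -/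
def slopeUp (n : ℕ) (c f : ℝ → ℝ) (lam r : ℝ) : ℝ := (lam + f r) / (c r + ((n : ℝ) - 1) / r)

/-- Minus the nonpositive root `p` of the stationary equation at `r`, where `c r > (n - 1) / r`. -/
def slopeDown (n : ℕ) (c f : ℝ → ℝ) (lam r : ℝ) : ℝ := (lam + f r) / (c r - ((n : ℝ) - 1) / r)

/-! ### Sign of the stationary operator between and outside its roots -/

section Operator

variable {n : ℕ} {c f : ℝ → ℝ} {lam r p : ℝ}

/-- As a function of `p` the operator has slope `-(c + (n - 1) / r)` on the right of `0` and `c - (n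
- 1) / r > 0` on the left, so each bound on `p` matters only on its own side of `0`. -/
theorem stationaryOp_pos (hm : 0 ≤ ((n : ℝ) - 1) / r) (hcr : ((n : ℝ) - 1) / r < c r)
    (h1 : -slopeDown n c f lam r < p) (h2 : p < slopeUp n c f lam r) :
    0 < stationaryOp n c f lam r p := by
  unfold stationaryOp
  rcases le_total 0 p with hp | hp
  · rw [abs_of_nonneg hp]
    rw [slopeUp, lt_div_iff₀ (by linarith)] at h2
    linarith
  · rw [abs_of_nonpos hp]
    have h3 : -p < slopeDown n c f lam r := by linarith
    rw [slopeDown, lt_div_iff₀ (by linarith)] at h3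
    linarith

theorem stationaryOp_neg_of_slopeUp_lt (hm : 0 ≤ ((n : ℝ) - 1) / r)
    (hcr : ((n : ℝ) - 1) / r < c r) (hf : 0 ≤ lam + f r) (hp : slopeUp n c f lam r < p) :
    stationaryOp n c f lam r p < 0 := by
  have h0 : 0 ≤ slopeUp n c f lam r := div_nonneg hf (by linarith)
  rw [stationaryOp, abs_of_nonneg (h0.trans hp.le)]
  rw [slopeUp, div_lt_iff₀ (by linarith)] at hp
  linarith

theorem stationaryOp_neg_of_lt_neg_slopeDown (hcr : ((n : ℝ) - 1) / r < c r)
    (hf : 0 ≤ lam + f r) (hp : p < -slopeDown n c f lam r) :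
    stationaryOp n c f lam r p < 0 := by
  have h0 : 0 ≤ slopeDown n c f lam r := div_nonneg hf (by linarith)
  rw [stationaryOp, abs_of_nonpos (by linarith)]
  have h3 : slopeDown n c f lam r < -p := by linarith
  rw [slopeDown, div_lt_iff₀ (by linarith)] at h3
  linarith

end Operator

/-! ### Test functions from increments -/

section Test

variable {R : ℝ} {w : ℝ → ℝ}

/-- If the increments of `w` from `z` to `x` and from `x` to `y` compare with the integrals of `q`
as for an interior maximum, then `w` minus an antiderivative of `q` has a local maximum. For
`y = R` no condition on the right of `x` is needed, and the maximum may lie at `R`. -/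
theorem exists_isLocalMaxOn (hw : ContinuousOn w (Icc 0 R)) {q : ℝ → ℝ} {x y z : ℝ}
    (hz : 0 ≤ z) (hzx : z < x) (hxy : x ≤ y) (hyR : y ≤ R) (hq : ContinuousOn q (Icc z y))
    (h1 : ∫ s in z..x, q s < w x - w z)
    (h2 : y = R ∨ w y - w x < ∫ s in x..y, q s) :
    ∃ ψ : ℝ → ℝ, ContDiff ℝ 1 ψ ∧ ∃ t ∈ Ioc z y, (t < y ∨ y = R) ∧ deriv ψ t = q t ∧
      IsLocalMaxOn (fun s => w s - ψ s) (Icc 0 R) t := by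
  have hzy : z ≤ y := hzx.le.trans hxy
  -- Constant extension beyond `[z, y]` makes the antiderivative `C¹` on the whole line, as test
  -- functions must be.
  set q' : ℝ → ℝ := IccExtend hzy ((Icc z y).domRestrict q) with hq'
  have hq'c : Continuous q' := (hq.domRestrict).Icc_extend'
  have hqq : ∀ s ∈ Icc z y, q' s = q s := fun s hs => by
    rw [hq', IccExtend_of_mem _ _ hs]; rfl
  set ψ : ℝ → ℝ := fun t => ∫ s in z..t, q' s with hψ
  have hd : ∀ t, HasDerivAt ψ (q' t) t := fun t => by
    simpa using hq'c.integral_hasStrictDerivAt z t |>.hasDerivAt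
  have hder : deriv ψ = q' := funext fun t => (hd t).deriv
  have hψ1 : ContDiff ℝ 1 ψ := by
    rw [contDiff_one_iff_deriv, hder]
    exact ⟨fun t => (hd t).differentiableAt, hq'c⟩
  have hsub : Icc z y ⊆ Icc 0 R := Icc_subset_Icc hz hyR
  have hcont : ContinuousOn (fun s => w s - ψ s) (Icc z y) :=
    (hw.mono hsub).sub hψ1.continuous.continuousOn
  obtain ⟨t, ht, hmax⟩ := isCompact_Icc.exists_isMaxOn (nonempty_Icc.2 hzy) hcont
  have hx : x ∈ Icc z y := ⟨hzx.le, hxy⟩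
  have hψz : ψ z = 0 := by simp [hψ]
  have hψx : ψ x = ∫ s in z..x, q s := by
    refine intervalIntegral.integral_congr fun s hs => hqq s ?_
    rw [uIcc_of_le hzx.le] at hs
    exact ⟨hs.1, hs.2.trans hxy⟩
  have hψy : ψ y - ψ x = ∫ s in x..y, q s := by
    rw [hψ]
    simp only
    rw [intervalIntegral.integral_interval_sub_left (hq'c.intervalIntegrable _ _)
      (hq'c.intervalIntegrable _ _)]
    refine intervalIntegral.integral_congr fun s hs => hqq s ?_
    rw [uIcc_of_le hxy] at hs
    exact ⟨hzx.le.trans hs.1, hs.2⟩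
  have htx : w x - ψ x ≤ w t - ψ t := hmax hx
  have htz : z < t := by
    refine ht.1.lt_of_ne fun h => ?_
    rw [← h] at htx
    linarith
  have hty : t < y ∨ y = R := by
    rcases h2 with h2 | h2
    · exact Or.inr h2
    · refine Or.inl (ht.2.lt_of_ne fun h => ?_)
      rw [h] at htx
      linarith
  refine ⟨ψ, hψ1, t, ⟨htz, ht.2⟩, hty, by rw [hder, hqq t ht], ?_⟩
  -- If `y = R`, then `[z, y]` is a neighbourhood of `t` relative to `[0, R]` even for `t = R`.
  have hnear : ∀ᶠ s in nhdsWithin t (Icc 0 R), s ∈ Icc z y := by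
    rcases hty with hty | hyR'
    · exact mem_nhdsWithin_of_mem_nhds (Icc_mem_nhds htz hty)
    · filter_upwards [mem_nhdsWithin_of_mem_nhds (Ioi_mem_nhds htz), self_mem_nhdsWithin]
        with s hs hs'
      exact ⟨le_of_lt hs, hyR' ▸ hs'.2⟩
  filter_upwards [hnear] with s hs using hmax hs

theorem exists_isLocalMinOn (hw : ContinuousOn w (Icc 0 R)) {q : ℝ → ℝ} {x y z : ℝ}
    (hz : 0 ≤ z) (hzx : z < x) (hxy : x < y) (hyR : y ≤ R) (hq : ContinuousOn q (Icc z y))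
    (h1 : w x - w z < ∫ s in z..x, q s) (h2 : ∫ s in x..y, q s < w y - w x) :
    ∃ ψ : ℝ → ℝ, ContDiff ℝ 1 ψ ∧ ∃ t ∈ Ioc z y, (t < y ∨ y = R) ∧ deriv ψ t = q t ∧
      IsLocalMinOn (fun s => w s - ψ s) (Icc 0 R) t := by
  obtain ⟨ψ, hψ, t, ht, hty, hd, hmax⟩ := exists_isLocalMaxOn (w := fun s => -w s) hw.neg
    (q := fun s => -q s) hz hzx hxy.le hyR hq.neg
    (by rw [intervalIntegral.integral_neg]; linarith)
    (Or.inr (by rw [intervalIntegral.integral_neg]; linarith))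
  refine ⟨fun s => -ψ s, hψ.neg, t, ht, hty, by rw [deriv.fun_neg, hd, neg_neg], ?_⟩
  filter_upwards [hmax] with s hs
  linarith

end Test

/-! ### The viscosity inequalities in terms of increments -/

section Viscosity

variable {n : ℕ} {R : ℝ} {c f : ℝ → ℝ} {φR lam : ℝ} {w : ℝ → ℝ}

theorem IsViscositySolution.continuousOn (h : IsViscositySolution n R c f φR lam w) :
    ContinuousOn w (Icc 0 R) :=
  continuousOn_iff_lower_upperSemicontinuousOn.2 ⟨h.2.1, h.1.1⟩

/-- Used by contradiction: along a field `q` of slopes with positive operator, `w` cannot rise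
faster than `q` and then slower. This is the ban on concave kinks. -/
theorem IsViscositySubsolution.exists_stationaryOp_nonpos
    (h : IsViscositySubsolution n R c f φR lam w) (hw : ContinuousOn w (Icc 0 R))
    {q : ℝ → ℝ} {x y z : ℝ} (hz : 0 ≤ z) (hzx : z < x) (hxy : x ≤ y) (hyR : y < R)
    (hq : ContinuousOn q (Icc z y))
    (h1 : ∫ s in z..x, q s < w x - w z) (h2 : w y - w x < ∫ s in x..y, q s) :
    ∃ t ∈ Ioo z y, stationaryOp n c f lam t (q t) ≤ 0 := by
  obtain ⟨ψ, hψ, t, ht, hty, hd, hmax⟩ :=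
    exists_isLocalMaxOn hw hz hzx hxy hyR.le hq h1 (Or.inr h2)
  have hty : t < y := hty.resolve_right hyR.ne
  refine ⟨t, ⟨ht.1, hty⟩, ?_⟩
  rw [← hd]
  exact (h.2 ψ hψ).1 t ⟨hz.trans_lt ht.1, hty.trans hyR⟩ hmax

/-- With no condition to the right of `x`, the maximum may fall on `R`. The Neumann condition then
gives either the equation at `R`, merged with the interior case, or the slope bound. -/
theorem IsViscositySubsolution.exists_boundary
    (h : IsViscositySubsolution n R c f φR lam w) (hw : ContinuousOn w (Icc 0 R))
    {q : ℝ → ℝ} {x z : ℝ} (hz : 0 ≤ z) (hzx : z < x) (hxR : x ≤ R)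
    (hq : ContinuousOn q (Icc z R)) (h1 : ∫ s in z..x, q s < w x - w z) :
    (∃ t ∈ Ioc z R, stationaryOp n c f lam t (q t) ≤ 0) ∨ q R ≤ φR := by
  obtain ⟨ψ, hψ, t, ht, -, hd, hmax⟩ :=
    exists_isLocalMaxOn hw hz hzx hxR le_rfl hq h1 (Or.inl rfl)
  rcases ht.2.lt_or_eq with htR | rfl
  · refine Or.inl ⟨t, ht, ?_⟩
    rw [← hd]
    exact (h.2 ψ hψ).1 t ⟨hz.trans_lt ht.1, htR⟩ hmax
  · have := (h.2 ψ hψ).2 hmax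
    rw [hd] at this
    rcases min_le_iff.1 this with h3 | h3
    · exact Or.inl ⟨t, ht, h3⟩
    · exact Or.inr (by linarith)

theorem IsViscositySupersolution.exists_stationaryOp_nonneg
    (h : IsViscositySupersolution n R c f φR lam w) (hw : ContinuousOn w (Icc 0 R))
    {q : ℝ → ℝ} {x y z : ℝ} (hz : 0 ≤ z) (hzx : z < x) (hxy : x < y) (hyR : y < R)
    (hq : ContinuousOn q (Icc z y))
    (h1 : w x - w z < ∫ s in z..x, q s) (h2 : ∫ s in x..y, q s < w y - w x) :
    ∃ t ∈ Ioo z y, 0 ≤ stationaryOp n c f lam t (q t) := by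
  obtain ⟨ψ, hψ, t, ht, hty, hd, hmin⟩ := exists_isLocalMinOn hw hz hzx hxy hyR.le hq h1 h2
  have hty : t < y := hty.resolve_right hyR.ne
  refine ⟨t, ⟨ht.1, hty⟩, ?_⟩
  rw [← hd]
  exact (h.2 ψ hψ).1 t ⟨hz.trans_lt ht.1, hty.trans hyR⟩ hmin

end Viscosity

/-! ### Perturbing slopes and integrals -/

section RealAnalysis

theorem exists_lt_mul_of_lt {u v : ℝ} (h : v < u) : ∃ δ ∈ Ioo (0 : ℝ) 1,
    ∀ η ∈ Ioo δ 1, v < η * u := by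
  have h1 : ∀ᶠ η in nhds (1 : ℝ), v < η * u :=
    (continuous_id.mul continuous_const).tendsto' 1 (1 * u) rfl |>.eventually_const_lt (by simpa)
  obtain ⟨l, hl, hl'⟩ := exists_Ioc_subset_of_mem_nhds h1 ⟨0, one_pos⟩
  exact ⟨max l (1 / 2), ⟨by positivity, max_lt hl (by norm_num)⟩,
    fun η hη => hl' ⟨(le_max_left _ _).trans_lt hη.1, hη.2.le⟩⟩

/-- A continuous function can be enlarged so that its integral changes little over one interval
and becomes large over another one. -/
theorem exists_continuousOn_gt_integral {p k : ℝ → ℝ} {l u x₁ x₂ y₁ y₂ A B : ℝ}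
    (hp : ContinuousOn p (Icc l u)) (hk : Continuous k) (hk0 : ∀ s, 0 ≤ k s)
    (hx : x₁ < x₂) (hy : y₁ < y₂) (hx₁ : l ≤ x₁) (hx₂ : x₂ ≤ u) (hy₁ : l ≤ y₁) (hy₂ : y₂ ≤ u)
    (hkx : ∀ s ∈ Icc x₁ x₂, k s = 0) (hky : ∀ s ∈ Ioo y₁ y₂, 0 < k s)
    (hA : ∫ s in x₁..x₂, p s < A) :
    ∃ q : ℝ → ℝ, ContinuousOn q (Icc l u) ∧ (∀ s, p s < q s) ∧
      ∫ s in x₁..x₂, q s < A ∧ B < ∫ s in y₁..y₂, q s := by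
  have hJ : 0 < ∫ s in y₁..y₂, k s :=
    intervalIntegral.intervalIntegral_pos_of_pos_on (hk.intervalIntegrable _ _) hky hy
  set J := ∫ s in y₁..y₂, k s
  obtain ⟨ε, hε, hεA⟩ : ∃ ε : ℝ, 0 < ε ∧ ∫ s in x₁..x₂, p s + ε < A := by
    have hip : IntervalIntegrable p MeasureTheory.volume x₁ x₂ :=
      (hp.mono (Icc_subset_Icc hx₁ hx₂)).intervalIntegrable_of_Icc hx.le
    refine ⟨(A - ∫ s in x₁..x₂, p s) / (2 * (x₂ - x₁)),
      div_pos (by linarith) (by linarith), ?_⟩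
    rw [intervalIntegral.integral_add hip (by simp), intervalIntegral.integral_const, smul_eq_mul]
    have : x₂ - x₁ ≠ 0 := by linarith
    field_simp
    linarith
  have hpε : ContinuousOn (fun s => p s + ε) (Icc l u) := hp.add continuousOn_const
  set I := ∫ s in y₁..y₂, p s + ε
  -- This multiple of the bump `k` makes up for the deficit `B - I`, with a margin of at least `1`;
  -- on `[x₁, x₂]` the bump vanishes.
  set K := (|B - I| + 1) / J with hK
  have hK0 : 0 ≤ K := by positivity
  refine ⟨fun s => p s + ε + K * k s, hpε.add (hk.const_mul K).continuousOn, fun s => ?_, ?_, ?_⟩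
  · have := mul_nonneg hK0 (hk0 s)
    linarith
  · rw [intervalIntegral.integral_congr (g := fun s => p s + ε)]
    · exact hεA
    · intro s hs
      rw [uIcc_of_le hx.le] at hs
      simp [hkx s hs]
  · rw [intervalIntegral.integral_add
      ((hpε.mono (Icc_subset_Icc hy₁ hy₂)).intervalIntegrable_of_Icc hy.le)
      ((hk.const_mul K).intervalIntegrable _ _), intervalIntegral.integral_const_mul]
    have h1 : K * J = |B - I| + 1 := by rw [hK]; field_simp
    change B < I + K * J
    have := le_abs_self (B - I)
    linarith

theorem eqOn_Icc_of_sub_eq {u v : ℝ → ℝ} {l r x₀ : ℝ} (hu : ContinuousOn u (Icc l r))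
    (hv : ContinuousOn v (Icc l r))
    (h : ∀ x ∈ Ioo l r, ∀ y ∈ Ioo l r, x < y → u y - u x = v y - v x)
    (hx₀ : x₀ ∈ Icc l r) (h0 : u x₀ = v x₀) : EqOn u v (Icc l r) := by
  rcases hx₀.1.trans hx₀.2 |>.eq_or_lt with rfl | hlr
  · intro x hx
    rw [Icc_self, mem_singleton_iff] at hx hx₀
    rw [hx, ← hx₀, h0]
  obtain ⟨m, hm⟩ := exists_between hlr
  have h1 : EqOn (fun x => u x - v x) (fun _ => u m - v m) (Ioo l r) := by
    intro x hx
    rcases lt_trichotomy x m with hxm | rfl | hxm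
    · have := h x hx m hm hxm
      simp only
      linarith
    · rfl
    · have := h m hm x hx hxm
      simp only
      linarith
  have h2 : EqOn (fun x => u x - v x) (fun _ => u m - v m) (Icc l r) :=
    h1.of_subset_closure (hu.sub hv) continuousOn_const Ioo_subset_Icc_self
      (closure_Ioo hlr.ne).ge
  intro x hx
  have h3 := h2 hx
  have h4 := h2 hx₀
  simp only at h3 h4
  linarith

end RealAnalysis

/-! ### Consequences of coercivity at and beyond the crossing radius -/

section Coercivity

variable {n : ℕ} {R : ℝ} {c : ℝ → ℝ}

theorem Coercive.mul_abs_derivWithin_lt (hn : 2 ≤ n) (hco : Coercive n R c) {r : ℝ}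
    (hr : r ∈ Icc (0 : ℝ) R) : ((n : ℝ) - 1) * |derivWithin c (Icc 0 R) r| < c r ^ 2 := by
  obtain ⟨δ, hδ, H⟩ := hco
  have hn1 : (0 : ℝ) < (n : ℝ) - 1 := by
    have : (2 : ℝ) ≤ n := by exact_mod_cast hn
    linarith
  have h := (le_max_left _ _).trans_lt (H r hr)
  have h2 : |derivWithin c (Icc 0 R) r| < 1 / ((n : ℝ) - 1) * c r ^ 2 := by linarith
  calc ((n : ℝ) - 1) * |derivWithin c (Icc 0 R) r|
      < ((n : ℝ) - 1) * (1 / ((n : ℝ) - 1) * c r ^ 2) := by gcongr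
    _ = c r ^ 2 := by field_simp

theorem Coercive.pos (hn : 2 ≤ n) (hc0 : ∀ r ∈ Icc (0 : ℝ) R, 0 ≤ c r) (hco : Coercive n R c)
    {r : ℝ} (hr : r ∈ Icc (0 : ℝ) R) : 0 < c r := by
  have hn1 : (2 : ℝ) ≤ n := by exact_mod_cast hn
  have h := hco.mul_abs_derivWithin_lt hn hr
  have h3 : 0 < c r ^ 2 :=
    (mul_nonneg (by linarith) (abs_nonneg _)).trans_lt h
  exact (hc0 r hr).lt_of_ne fun h4 => by rw [← h4] at h3; simp at h3

/-- The derivative is `-(n - 1) c' / c ^ 2 - 1`, and coercivity gives `(n - 1) |c'| < c ^ 2`. -/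
theorem Coercive.strictAntiOn (hn : 2 ≤ n) (hc : ContDiffOn ℝ 1 c (Icc 0 R))
    (hc0 : ∀ r ∈ Icc (0 : ℝ) R, 0 ≤ c r) (hco : Coercive n R c) :
    StrictAntiOn (fun r => ((n : ℝ) - 1) / c r - r) (Icc 0 R) := by
  have hn1 : (2 : ℝ) ≤ n := by exact_mod_cast hn
  have hpos : ∀ r ∈ Icc (0 : ℝ) R, 0 < c r := fun r hr => hco.pos hn hc0 hr
  apply strictAntiOn_of_deriv_neg (convex_Icc 0 R)
  · exact (continuousOn_const.div hc.continuousOn fun r hr => (hpos r hr).ne').sub continuousOn_id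
  · intro r hr
    rw [interior_Icc] at hr
    have hr' : r ∈ Icc (0 : ℝ) R := Ioo_subset_Icc_self hr
    have hd : HasDerivAt c (derivWithin c (Icc 0 R) r) r :=
      ((hc.differentiableOn (by norm_num) r hr').hasDerivWithinAt).hasDerivAt
        (Icc_mem_nhds hr.1 hr.2)
    have hd2 := ((hasDerivAt_const r ((n : ℝ) - 1)).div hd (hpos r hr').ne').sub (hasDerivAt_id r)
    have hd3 : deriv (fun r => ((n : ℝ) - 1) / c r - r) r = _ := hd2.deriv
    rw [hd3]
    have hp := hpos r hr'
    rw [sub_neg, div_lt_one (by positivity)]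
    have := hco.mul_abs_derivWithin_lt hn hr'
    have h5 := neg_abs_le (derivWithin c (Icc 0 R) r)
    nlinarith

/-- Beyond the crossing radius, `c` lies above `(n - 1) / r`. -/
theorem Coercive.div_lt (hn : 2 ≤ n) (hc : ContDiffOn ℝ 1 c (Icc 0 R))
    (hc0 : ∀ r ∈ Icc (0 : ℝ) R, 0 ≤ c r) (hco : Coercive n R c) {a : ℝ}
    (ha : a ∈ crossingSet n R c) {r : ℝ} (hr : r ∈ Ioc a R) : ((n : ℝ) - 1) / r < c r := by
  obtain ⟨⟨ha0, haR⟩, hca⟩ := ha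
  have hr0 : 0 < r := ha0.trans hr.1
  have hrI : r ∈ Icc (0 : ℝ) R := ⟨hr0.le, hr.2⟩
  have haI : a ∈ Icc (0 : ℝ) R := ⟨ha0.le, haR⟩
  have h := hco.strictAntiOn hn hc hc0 haI hrI hr.1
  have hpa := hco.pos hn hc0 haI
  have hp := hco.pos hn hc0 hrI
  have h0 : ((n : ℝ) - 1) / c a - a = 0 := by
    rw [sub_eq_zero, div_eq_iff hpa.ne', hca]
    field_simp
  simp only [h0, sub_neg] at h
  rw [div_lt_iff₀ hp] at h
  rw [div_lt_iff₀ hr0]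
  linarith

/-- Both curves are Lipschitz on `[a, R]` and agree at `a`. This makes `slopeDown` at least a
multiple of `1 / (r - a)` where `lam + f` is bounded below by a positive constant, hence not
integrable at `a`. -/
theorem exists_sub_div_le (hn : 2 ≤ n) (hc : ContDiffOn ℝ 1 c (Icc 0 R)) {a : ℝ}
    (ha : a ∈ crossingSet n R c) :
    ∃ L : ℝ, 0 < L ∧ ∀ r ∈ Icc a R, c r - ((n : ℝ) - 1) / r ≤ L * (r - a) := by
  obtain ⟨⟨ha0, haR⟩, hca⟩ := ha
  have hn1 : (2 : ℝ) ≤ n := by exact_mod_cast hn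
  have hR : 0 < R := ha0.trans_le haR
  obtain ⟨C, hC⟩ := isCompact_Icc.exists_bound_of_continuousOn
    (hc.continuousOn_derivWithin (uniqueDiffOn_Icc hR) le_rfl)
  have hC0 : 0 ≤ C := (norm_nonneg _).trans (hC 0 ⟨le_rfl, hR.le⟩)
  refine ⟨C + ((n : ℝ) - 1) / (a * a),
    add_pos_of_nonneg_of_pos hC0 (div_pos (by linarith) (by positivity)), fun r hr => ?_⟩
  have hr0 : 0 < r := ha0.trans_le hr.1
  have h1 : c r - c a ≤ C * (r - a) := by
    have := Convex.norm_image_sub_le_of_norm_derivWithin_le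
      (hc.differentiableOn (by norm_num)) hC (convex_Icc 0 R) ⟨ha0.le, haR⟩
      (⟨hr0.le, hr.2⟩ : r ∈ Icc 0 R)
    rw [Real.norm_eq_abs, Real.norm_eq_abs, abs_of_nonneg (sub_nonneg.2 hr.1)] at this
    exact (le_abs_self _).trans this
  have h2 : ((n : ℝ) - 1) / a - ((n : ℝ) - 1) / r ≤ ((n : ℝ) - 1) / (a * a) * (r - a) := by
    have h3 : ((n : ℝ) - 1) / a - ((n : ℝ) - 1) / r = ((n : ℝ) - 1) / (a * r) * (r - a) := by
      field_simp
    rw [h3]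
    have h4 : 0 ≤ r - a := sub_nonneg.2 hr.1
    have h5 : (0 : ℝ) ≤ (n : ℝ) - 1 := by linarith
    have h6 := hr.1
    gcongr
  rw [hca] at h1
  linarith

end Coercivity

/-! ### Increments of solutions are integrals of the roots -/

section Increments

variable {n : ℕ} {R : ℝ} {c f : ℝ → ℝ} {φR lam a b : ℝ} {w : ℝ → ℝ}

theorem continuousOn_div_id (ha : 0 < a) :
    ContinuousOn (fun t : ℝ => ((n : ℝ) - 1) / t) (Icc a R) :=
  continuousOn_const.div continuousOn_id fun _ ht => (ha.trans_le ht.1).ne'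

theorem continuousOn_slopeUp (hn : 2 ≤ n) (hc : ContinuousOn c (Icc 0 R))
    (hf : ContinuousOn f (Icc 0 R)) (hc0 : ∀ r ∈ Icc (0 : ℝ) R, 0 ≤ c r) (ha : 0 < a) :
    ContinuousOn (slopeUp n c f lam) (Icc a R) := by
  have hn1 : (2 : ℝ) ≤ n := by exact_mod_cast hn
  have hs : Icc a R ⊆ Icc 0 R := Icc_subset_Icc_left ha.le
  refine (continuousOn_const.add (hf.mono hs)).div
    ((hc.mono hs).add (continuousOn_div_id ha)) fun t ht => ?_
  have h1 := hc0 t (hs ht)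
  have h2 : 0 < ((n : ℝ) - 1) / t := div_pos (by linarith) (ha.trans_le ht.1)
  exact (add_pos_of_nonneg_of_pos h1 h2).ne'

theorem continuousOn_slopeDown (hc : ContinuousOn c (Icc 0 R))
    (hf : ContinuousOn f (Icc 0 R)) (ha : 0 < a) (hcr : ∀ r ∈ Icc a R, ((n : ℝ) - 1) / r < c r) :
    ContinuousOn (slopeDown n c f lam) (Icc a R) := by
  have hs : Icc a R ⊆ Icc 0 R := Icc_subset_Icc_left ha.le
  exact (continuousOn_const.add (hf.mono hs)).div
    ((hc.mono hs).sub (continuousOn_div_id ha)) fun t ht => (sub_pos.2 (hcr t ht)).ne'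

/-- Were it false, `slopeUp` could be raised to a `q` whose integral over `[x, y]` is still too
small but whose integral over some `[z, x]` is huge. Then `w` minus an antiderivative of `q` has an
interior minimum, where the operator is negative. -/
theorem IsViscositySolution.sub_le_integral_slopeUp (hn : 2 ≤ n)
    (h : IsViscositySolution n R c f φR lam w) (hc : ContinuousOn c (Icc 0 R))
    (hf : ContinuousOn f (Icc 0 R)) (hc0 : ∀ r ∈ Icc (0 : ℝ) R, 0 ≤ c r) (ha : 0 < a)
    (hcr : ∀ r ∈ Ioc a R, ((n : ℝ) - 1) / r < c r) (hbR : b ≤ R)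
    (hpos : ∀ r ∈ Ioo a b, 0 < lam + f r) {x y : ℝ} (hx : a < x) (hxy : x < y) (hy : y < b) :
    w y - w x ≤ ∫ s in x..y, slopeUp n c f lam s := by
  have hn1 : (2 : ℝ) ≤ n := by exact_mod_cast hn
  by_contra! hlt
  obtain ⟨z, haz, hzx⟩ := exists_between hx
  have hyR : y < R := hy.trans_le hbR
  obtain ⟨q, hq, hpq, h1, h2⟩ := exists_continuousOn_gt_integral (B := w x - w z)
    (k := fun s => max 0 (x - s)) (l := z) (u := y)
    ((continuousOn_slopeUp (lam := lam) hn hc hf hc0 ha).mono (Icc_subset_Icc haz.le hyR.le))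
    (by fun_prop) (fun s => le_max_left _ _) hxy hzx hzx.le le_rfl le_rfl hxy.le
    (fun s hs => max_eq_left (by linarith [hs.1]))
    (fun s hs => lt_max_of_lt_right (by linarith [hs.2])) hlt
  obtain ⟨t, ht, hG⟩ := h.2.exists_stationaryOp_nonneg h.continuousOn (ha.trans haz).le hzx hxy
    hyR hq h2 h1
  have hat : a < t := haz.trans ht.1
  exact hG.not_gt (stationaryOp_neg_of_slopeUp_lt (div_nonneg (by linarith) (ha.trans hat).le)
    (hcr t ⟨hat, ht.2.le.trans hyR.le⟩) (hpos t ⟨hat, ht.2.trans hy⟩).le (hpq t))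

/-- Mirror image of `sub_le_integral_slopeUp`: the test slope is `-q` with `q > slopeDown`, and the
room for making `q` large lies to the right of `y`. -/
theorem IsViscositySolution.neg_integral_slopeDown_le
    (h : IsViscositySolution n R c f φR lam w) (hc : ContinuousOn c (Icc 0 R))
    (hf : ContinuousOn f (Icc 0 R)) (ha : 0 < a)
    (hcr : ∀ r ∈ Ioc a R, ((n : ℝ) - 1) / r < c r) (hbR : b ≤ R)
    (hpos : ∀ r ∈ Ioo a b, 0 < lam + f r) {x y : ℝ} (hx : a < x) (hxy : x < y) (hy : y < b) :
    -∫ s in x..y, slopeDown n c f lam s ≤ w y - w x := by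
  by_contra! hlt
  obtain ⟨z, hyz, hzb⟩ := exists_between hy
  have hzR : z < R := hzb.trans_le hbR
  obtain ⟨q, hq, hpq, h1, h2⟩ := exists_continuousOn_gt_integral (B := -(w z - w y))
    (A := -(w y - w x)) (k := fun s => max 0 (s - y)) (l := x) (u := z)
    ((continuousOn_slopeDown (lam := lam) hc hf (ha.trans hx)
      (fun r hr => hcr r ⟨hx.trans_le hr.1, hr.2⟩)).mono (Icc_subset_Icc_right hzR.le))
    (by fun_prop) (fun s => le_max_left _ _) hxy hyz le_rfl hyz.le hxy.le le_rfl
    (fun s hs => max_eq_left (by linarith [hs.2]))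
    (fun s hs => lt_max_of_lt_right (by linarith [hs.1])) (by linarith)
  obtain ⟨t, ht, hG⟩ := h.2.exists_stationaryOp_nonneg h.continuousOn (ha.trans hx).le hxy hyz
    hzR (q := fun s => -q s) hq.neg
    (by rw [intervalIntegral.integral_neg]; linarith)
    (by rw [intervalIntegral.integral_neg]; linarith)
  have hat : a < t := hx.trans ht.1
  exact hG.not_gt (stationaryOp_neg_of_lt_neg_slopeDown (hcr t ⟨hat, ht.2.le.trans hzR.le⟩)
    (hpos t ⟨hat, ht.2.trans hzb⟩).le (neg_lt_neg (hpq t)))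

/-- A solution cannot decrease to the right of the crossing radius `a`: going back to `a` it would
decrease with slope `-slopeDown`, which is not integrable at `a`. -/
theorem IsViscositySolution.integral_slopeUp_le (hn : 2 ≤ n)
    (h : IsViscositySolution n R c f φR lam w) (hc : ContDiffOn ℝ 1 c (Icc 0 R))
    (hf : ContinuousOn f (Icc 0 R)) (hc0 : ∀ r ∈ Icc (0 : ℝ) R, 0 ≤ c r)
    (ha : a ∈ crossingSet n R c)
    (hcr : ∀ r ∈ Ioc a R, ((n : ℝ) - 1) / r < c r) (hbR : b ≤ R)
    (hpos : ∀ r ∈ Ico a b, 0 < lam + f r) {x y : ℝ} (hx : a < x) (hxy : x < y) (hy : y < b) :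
    ∫ s in x..y, slopeUp n c f lam s ≤ w y - w x := by
  have hn1 : (2 : ℝ) ≤ n := by exact_mod_cast hn
  have ha0 : 0 < a := ha.1.1
  have hyR : y < R := hy.trans_le hbR
  have hxa : 0 < x - a := sub_pos.2 hx
  by_contra! hlt
  obtain ⟨δ, hδ, hη⟩ := exists_lt_mul_of_lt hlt
  obtain ⟨η, hη1⟩ := exists_between hδ.2
  have hη0 : 0 < η := hδ.1.trans hη1.1
  replace hη := hη η hη1
  obtain ⟨L, hL, hLc⟩ := exists_sub_div_le hn hc ha
  obtain ⟨t₀, ht₀, hmin⟩ := isCompact_Icc.exists_isMinOn (nonempty_Icc.2 hx.le)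
    ((continuousOn_const (c := lam)).add
      (hf.mono (Icc_subset_Icc ha0.le (hxy.trans hyR).le)))
  have hμ : 0 < lam + f t₀ := hpos t₀ ⟨ht₀.1, ht₀.2.trans_lt (hxy.trans hy)⟩
  set μ := lam + f t₀
  have hμle : ∀ s ∈ Icc a x, μ ≤ lam + f s := fun s hs => hmin hs
  -- Half of `μ / L`, so that `κ / (s - a)` stays strictly below `slopeDown` on `(a, x]`.
  set κ := μ / (2 * L) with hκ
  have hκ0 : 0 < κ := by positivity
  have hκL : κ * L < μ := by
    rw [hκ]
    field_simp
    linarith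
  have hup : ContinuousOn (slopeUp n c f lam) (Icc a R) :=
    continuousOn_slopeUp hn hc.continuousOn hf hc0 ha0
  have hup0 : ∀ s ∈ Ico a b, 0 < slopeUp n c f lam s := fun s hs => by
    have hs0 : 0 < s := ha0.trans_le hs.1
    have h1 := hc0 s ⟨hs0.le, hs.2.le.trans hbR⟩
    have h2 : 0 < ((n : ℝ) - 1) / s := div_pos (by linarith) hs0
    exact div_pos (hpos s hs) (add_pos_of_nonneg_of_pos h1 h2)
  obtain ⟨W, hW⟩ := isCompact_Icc.exists_bound_of_continuousOn h.continuousOn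
  have hW0 : 0 ≤ W := (norm_nonneg _).trans (hW a ⟨ha0.le, ha.1.2⟩)
  have hxb : x < b := hxy.trans hy
  set I := ∫ s in a..x, slopeUp n c f lam s with hI
  have hI0 : 0 ≤ I := intervalIntegral.integral_nonneg hx.le
    fun s hs => (hup0 s ⟨hs.1, hs.2.trans_lt hxb⟩).le
  -- `T` will be the integral of `1 / (s - a)` over `[z, x]`. Cutting off at `x` costs at most `1`,
  -- so `κ * k` integrates to at least `I + 2 * W + κ`, which exceeds the integral of `slopeUp` plus
  -- any oscillation of `w`.
  set T := (I + 2 * W) / κ + 2 with hT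
  have hT0 : 0 < T := by positivity
  set z := a + (x - a) * Real.exp (-T) with hz
  have haz : a < z := by
    have := mul_pos hxa (Real.exp_pos (-T))
    linarith
  have hzx : z < x := by
    have h1 : Real.exp (-T) < 1 := by simpa using hT0
    nlinarith
  have hzR : z ∈ Icc 0 R := ⟨(ha0.trans haz).le, (hzx.trans (hxy.trans hyR)).le⟩
  have hxR : x ∈ Icc 0 R := ⟨(ha0.trans hx).le, (hxy.trans hyR).le⟩
  have hinv : ContinuousOn (fun s => 1 / (s - a)) (Icc z y) :=
    continuousOn_const.div (by fun_prop) fun s hs => by linarith [hs.1]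
  set k : ℝ → ℝ := fun s => max 0 (1 / (s - a) - 1 / (x - a)) with hk
  have hkc : ContinuousOn k (Icc z y) :=
    continuousOn_const.sup (hinv.sub continuousOn_const)
  have hup' : ContinuousOn (slopeUp n c f lam) (Icc z y) :=
    hup.mono (Icc_subset_Icc haz.le hyR.le)
  have hk_right : ∀ s, x ≤ s → k s = 0 := fun s hs =>
    max_eq_left (sub_nonpos.2 (one_div_le_one_div_of_le hxa (by linarith)))
  have hk_left : ∀ s ∈ Icc z x, k s = 1 / (s - a) - 1 / (x - a) := fun s hs =>
    max_eq_right (sub_nonneg.2 (one_div_le_one_div_of_le (by linarith [hs.1]) (by linarith [hs.2])))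
  have hIz : ∫ s in z..x, slopeUp n c f lam s ≤ I := by
    have hi1 : IntervalIntegrable (slopeUp n c f lam) MeasureTheory.volume a z :=
      (hup.mono (Icc_subset_Icc_right hzR.2)).intervalIntegrable_of_Icc haz.le
    have hi2 : IntervalIntegrable (slopeUp n c f lam) MeasureTheory.volume z x :=
      (hup.mono (Icc_subset_Icc haz.le hxR.2)).intervalIntegrable_of_Icc hzx.le
    rw [hI, ← intervalIntegral.integral_add_adjacent_intervals hi1 hi2]
    have : 0 ≤ ∫ s in a..z, slopeUp n c f lam s := intervalIntegral.integral_nonneg haz.le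
      fun s hs => (hup0 s ⟨hs.1, hs.2.trans_lt (hzx.trans hxb)⟩).le
    linarith
  have hIz0 : 0 ≤ ∫ s in z..x, slopeUp n c f lam s := intervalIntegral.integral_nonneg hzx.le
    fun s hs => (hup0 s ⟨haz.le.trans hs.1, hs.2.trans_lt hxb⟩).le
  have hik : ∫ s in z..x, k s = T - (x - z) / (x - a) := by
    rw [intervalIntegral.integral_congr (g := fun s => 1 / (s - a) - 1 / (x - a))
      (fun s hs => hk_left s (by rwa [uIcc_of_le hzx.le] at hs)),
      intervalIntegral.integral_sub
        ((hinv.mono (Icc_subset_Icc_right hxy.le)).intervalIntegrable_of_Icc hzx.le) (by simp),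
      intervalIntegral.integral_comp_sub_right (fun u => 1 / u) a,
      integral_one_div_of_pos (by linarith) hxa, intervalIntegral.integral_const, smul_eq_mul]
    have h1 : (x - a) / (z - a) = Real.exp T := by
      rw [hz, add_sub_cancel_left, Real.exp_neg]
      field_simp
    rw [h1, Real.log_exp]
    ring
  -- The test slope is `η * slopeUp` on `[x, y]` and dives towards `-κ / (s - a)` near `a`, always
  -- strictly between the roots.
  have hq : ContinuousOn (fun s => η * slopeUp n c f lam s - κ * k s) (Icc z y) :=
    (continuousOn_const.mul hup').sub (continuousOn_const.mul hkc)
  have hi₁ : IntervalIntegrable (fun s => η * slopeUp n c f lam s) MeasureTheory.volume z x :=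
    (continuousOn_const.mul
      (hup'.mono (Icc_subset_Icc_right hxy.le))).intervalIntegrable_of_Icc hzx.le
  have hi₂ : IntervalIntegrable (fun s => κ * k s) MeasureTheory.volume z x :=
    (continuousOn_const.mul
      (hkc.mono (Icc_subset_Icc_right hxy.le))).intervalIntegrable_of_Icc hzx.le
  obtain ⟨t, ht, hG⟩ := h.1.exists_stationaryOp_nonpos h.continuousOn hzR.1 hzx hxy.le hyR hq
    (by
      rw [intervalIntegral.integral_sub hi₁ hi₂,
        intervalIntegral.integral_const_mul, intervalIntegral.integral_const_mul, hik]
      have h1 : (x - z) / (x - a) ≤ 1 := (div_le_one hxa).2 (by linarith)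
      have h2 := abs_le.1 (hW x hxR)
      have h3 := abs_le.1 (hW z hzR)
      have h4 : κ * T = I + 2 * W + κ * 2 := by
        rw [hT]
        field_simp
      have h5 : κ * ((x - z) / (x - a)) ≤ κ * 1 := mul_le_mul_of_nonneg_left h1 hκ0.le
      have h6 : η * ∫ s in z..x, slopeUp n c f lam s ≤ ∫ s in z..x, slopeUp n c f lam s :=
        mul_le_of_le_one_left hIz0 hη1.2.le
      rw [mul_sub, h4]
      linarith [h2.1, h3.2])
    (by
      rw [intervalIntegral.integral_congr (g := fun s => η * slopeUp n c f lam s),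
        intervalIntegral.integral_const_mul]
      · exact hη
      · intro s hs
        rw [uIcc_of_le hxy.le] at hs
        simp [hk_right s hs.1])
  have hat : a < t := haz.trans ht.1
  have htR : t ∈ Ioc a R := ⟨hat, ht.2.le.trans hyR.le⟩
  have htb : t ∈ Ico a b := ⟨hat.le, ht.2.trans hy⟩
  have hut := hup0 t htb
  have hcm : 0 < c t - ((n : ℝ) - 1) / t := sub_pos.2 (hcr t htR)
  have hdown : 0 < slopeDown n c f lam t := div_pos (hpos t htb) hcm
  have hk0 : 0 ≤ k t := le_max_left _ _
  refine hG.not_gt (stationaryOp_pos (div_nonneg (by linarith) (ha0.trans hat).le) (hcr t htR)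
    ?_ ?_)
  · rcases le_total x t with hxt | htx
    · rw [hk_right t hxt]
      have := mul_pos hη0 hut
      linarith
    · have hta : 0 < t - a := sub_pos.2 hat
      have h1 : k t ≤ 1 / (t - a) := by
        rw [hk_left t ⟨ht.1.le, htx⟩]
        have : 0 < 1 / (x - a) := by positivity
        linarith
      have h2 : κ * (1 / (t - a)) < slopeDown n c f lam t := by
        rw [slopeDown, lt_div_iff₀ hcm]
        calc κ * (1 / (t - a)) * (c t - ((n : ℝ) - 1) / t)
            ≤ κ * (1 / (t - a)) * (L * (t - a)) := by
              have := hLc t ⟨hat.le, htR.2⟩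
              gcongr
          _ = κ * L := by field_simp
          _ < μ := hκL
          _ ≤ lam + f t := hμle t ⟨hat.le, htx⟩
      have h3 : κ * k t ≤ κ * (1 / (t - a)) := mul_le_mul_of_nonneg_left h1 hκ0.le
      have := mul_pos hη0 hut
      linarith
  · have h1 : η * slopeUp n c f lam t < slopeUp n c f lam t := mul_lt_of_lt_one_left hut hη1.2
    have h2 := mul_nonneg hκ0.le hk0
    linarith

/-- The Neumann condition prevents a solution from increasing near `R`, if the prescribed slope
is below the nonnegative root of the stationary equation. -/
theorem IsViscositySolution.sub_le_neg_integral_slopeDown (hn : 2 ≤ n)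
    (h : IsViscositySolution n R c f φR lam w) (hc : ContinuousOn c (Icc 0 R))
    (hf : ContinuousOn f (Icc 0 R)) (hc0 : ∀ r ∈ Icc (0 : ℝ) R, 0 ≤ c r) (ha : 0 < a)
    (hcr : ∀ r ∈ Ioc a R, ((n : ℝ) - 1) / r < c r)
    (hpos : ∀ r ∈ Ioc a R, 0 < lam + f r) (hφ : φR < slopeUp n c f lam R)
    {x y : ℝ} (hx : a < x) (hxy : x < y) (hy : y < R) :
    w y - w x ≤ -∫ s in x..y, slopeDown n c f lam s := by
  have hn1 : (2 : ℝ) ≤ n := by exact_mod_cast hn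
  by_contra! hlt
  obtain ⟨δ, hδ, hη⟩ := exists_lt_mul_of_lt
    (show -(w y - w x) < ∫ s in x..y, slopeDown n c f lam s by linarith)
  obtain ⟨δ', hδ', hη'⟩ := exists_lt_mul_of_lt hφ
  obtain ⟨η, hηm, hη1⟩ := exists_between (max_lt hδ.2 hδ'.2)
  replace hη := hη η ⟨(le_max_left _ _).trans_lt hηm, hη1⟩
  replace hη' := hη' η ⟨(le_max_right _ _).trans_lt hηm, hη1⟩
  have hη0 : 0 < η := hδ.1.trans ((le_max_left _ _).trans_lt hηm)
  have hRy : 0 < R - y := sub_pos.2 hy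
  have hx0 : 0 < x := ha.trans hx
  -- `θ` ramps from `0` at `y` to `1` at `R`, moving the test slope from `-η * slopeDown` to `η *
  -- slopeUp`. The factor `η < 1` keeps it strictly between the roots, and `η` is close enough to
  -- `1` that its value at `R` exceeds `φR`.
  set θ : ℝ → ℝ := fun s => max 0 ((s - y) / (R - y)) with hθ
  have hθc : Continuous θ := by fun_prop
  have hθ_left : ∀ s, s ≤ y → θ s = 0 := fun s hs =>
    max_eq_left (div_nonpos_of_nonpos_of_nonneg (by linarith) hRy.le)
  have hθR : θ R = 1 := by simp [hθ, div_self hRy.ne']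
  have hθ1 : ∀ s, s ≤ R → θ s ≤ 1 := fun s hs =>
    max_le zero_le_one ((div_le_one hRy).2 (by linarith))
  have hq : ContinuousOn (fun s => η * (θ s * slopeUp n c f lam s -
      (1 - θ s) * slopeDown n c f lam s)) (Icc x R) :=
    continuousOn_const.mul ((hθc.continuousOn.mul
      (continuousOn_slopeUp hn hc hf hc0 hx0)).sub
      ((continuousOn_const.sub hθc.continuousOn).mul
        (continuousOn_slopeDown hc hf hx0 fun r hr => hcr r ⟨hx.trans_le hr.1, hr.2⟩)))
  rcases h.1.exists_boundary h.continuousOn hx0.le hxy hy.le hq (by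
      rw [intervalIntegral.integral_congr (g := fun s => -(η * slopeDown n c f lam s)),
        intervalIntegral.integral_neg, intervalIntegral.integral_const_mul]
      · linarith
      · intro s hs
        rw [uIcc_of_le hxy.le] at hs
        simp [hθ_left s hs.2]) with ⟨t, ht, hG⟩ | hq
  · have hat : a < t := hx.trans ht.1
    have ht0 : 0 < t := ha.trans hat
    have htR : t ∈ Ioc a R := ⟨hat, ht.2⟩
    have hm : 0 ≤ ((n : ℝ) - 1) / t := div_nonneg (by linarith) ht0.le
    have hcm := hcr t htR
    have hup : 0 < slopeUp n c f lam t := div_pos (hpos t htR) (by linarith)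
    have hdown : 0 < slopeDown n c f lam t := div_pos (hpos t htR) (by linarith)
    have hθ0 : 0 ≤ θ t := le_max_left _ _
    have hθ1' := hθ1 t ht.2
    have hu : θ t * slopeUp n c f lam t ≤ slopeUp n c f lam t := mul_le_of_le_one_left hup.le hθ1'
    have hu0 : 0 ≤ θ t * slopeUp n c f lam t := mul_nonneg hθ0 hup.le
    have hd : (1 - θ t) * slopeDown n c f lam t ≤ slopeDown n c f lam t :=
      mul_le_of_le_one_left hdown.le (by linarith)
    have hd0 : 0 ≤ (1 - θ t) * slopeDown n c f lam t := mul_nonneg (by linarith) hdown.le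
    refine hG.not_gt (stationaryOp_pos hm hcm ?_ ?_)
    · have h1 : η * ((1 - θ t) * slopeDown n c f lam t) < slopeDown n c f lam t :=
        (mul_le_mul_of_nonneg_left hd hη0.le).trans_lt (mul_lt_of_lt_one_left hdown hη1)
      have h2 := mul_nonneg hη0.le hu0
      rw [mul_sub]
      linarith
    · have h1 : η * (θ t * slopeUp n c f lam t) < slopeUp n c f lam t :=
        (mul_le_mul_of_nonneg_left hu hη0.le).trans_lt (mul_lt_of_lt_one_left hup hη1)
      have h2 := mul_nonneg hη0.le hd0
      rw [mul_sub]
      linarith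
  · simp only [hθR] at hq
    linarith

end Increments

/-! ### The payoff, the eigenvalue and the Aubry set -/

section Aubry

variable {n : ℕ} {R : ℝ} {c f : ℝ → ℝ} {φR a : ℝ}

theorem payoff_of_ne {r : ℝ} (h : r ≠ R) : payoff n R c f φR r = -f r := by
  simp [payoff, h]

theorem payoff_self : payoff n R c f φR R =
    -f R + φR * (((n : ℝ) - 1) / R + Real.sign φR * c R) := by
  simp [payoff]

/-- The boundary term equals `|φR| * c R + φR * (n - 1) / R`, which is nonnegative because `c R`
dominates `(n - 1) / R`. -/
theorem neg_le_payoff (hR : 0 ≤ ((n : ℝ) - 1) / R) (hcR : ((n : ℝ) - 1) / R ≤ c R) (r : ℝ) :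
    -f r ≤ payoff n R c f φR r := by
  rcases eq_or_ne r R with rfl | h
  · rw [payoff_self]
    rcases lt_trichotomy φR 0 with h | rfl | h
    · rw [Real.sign_of_neg h]
      nlinarith
    · simp
    · rw [Real.sign_of_pos h]
      nlinarith
  · rw [payoff_of_ne h]

/-- The difference `lam - payoff n R c f φR R` is the operator at `(R, φR)`. Its positivity places
`φR` strictly below the upper root. -/
theorem lt_slopeUp_of_payoff_lt {lam : ℝ} (hR : 0 ≤ ((n : ℝ) - 1) / R)
    (hcR : ((n : ℝ) - 1) / R < c R) (h : payoff n R c f φR R < lam) :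
    φR < slopeUp n c f lam R := by
  have h0 : -f R ≤ payoff n R c f φR R := neg_le_payoff hR hcR.le R
  rcases le_or_gt φR 0 with hφ | hφ
  · exact hφ.trans_lt (div_pos (by linarith) (by linarith))
  · rw [payoff_self, Real.sign_of_pos hφ] at h
    rw [slopeUp, lt_div_iff₀ (by linarith)]
    linarith

theorem eigenvalue_eq_sSup (ha : 0 < a) (haR : a ≤ R)
    (hcrit : critRadius n R c = (a : EReal)) :
    eigenvalue n R c f φR = sSup (payoff n R c f φR '' Icc a R) := by
  rw [eigenvalue, hcrit]
  congr 2
  ext r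
  simp only [mem_ofPred_eq, mem_Icc, EReal.coe_le_coe_iff]
  constructor
  · rintro ⟨h1, h2 | rfl⟩
    · exact ⟨h2, h1.2⟩
    · exact ⟨haR, le_rfl⟩
  · exact fun h => ⟨⟨ha.le.trans h.1, h.2⟩, Or.inl h.1⟩

theorem aubrySet_eq (ha : 0 < a) (hcrit : critRadius n R c = (a : EReal)) :
    aubrySet n R c f φR =
      {r | r ∈ Icc a R ∧ payoff n R c f φR r = eigenvalue n R c f φR} := by
  rw [aubrySet, hcrit, if_neg (EReal.coe_ne_top a)]
  ext r
  simp only [mem_ofPred_eq, mem_Icc, EReal.coe_le_coe_iff]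
  constructor
  · exact fun h => ⟨⟨h.2.1, h.1.2⟩, h.2.2⟩
  · exact fun h => ⟨⟨ha.le.trans h.1.1, h.1.2⟩, h.1.1, h.2⟩

/-- The payoff may be discontinuous at `R`, but it only jumps upwards there, so it is upper
semicontinuous. -/
theorem exists_isMaxOn_payoff (hf : ContinuousOn f (Icc a R)) (haR : a ≤ R)
    (hle : -f R ≤ payoff n R c f φR R) :
    ∃ t ∈ Icc a R, IsMaxOn (payoff n R c f φR) (Icc a R) t := by
  obtain ⟨t, ht, hmax⟩ := isCompact_Icc.exists_isMaxOn (nonempty_Icc.2 haR) hf.neg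
  have hmax' : ∀ r ∈ Icc a R, -f r ≤ -f t := fun r hr => hmax hr
  rcases le_or_gt (-f t) (payoff n R c f φR R) with h | h
  · refine ⟨R, ⟨haR, le_rfl⟩, fun r hr => ?_⟩
    rcases eq_or_ne r R with rfl | hrR
    · exact le_refl (payoff n r c f φR r)
    · change payoff n R c f φR r ≤ payoff n R c f φR R
      rw [payoff_of_ne hrR]
      exact (hmax' r hr).trans h
  · have htR : t ≠ R := by
      rintro rfl
      exact h.not_ge hle
    refine ⟨t, ht, fun r hr => ?_⟩
    change payoff n R c f φR r ≤ payoff n R c f φR t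
    rw [payoff_of_ne htR]
    rcases eq_or_ne r R with rfl | hrR
    · exact h.le
    · rw [payoff_of_ne hrR]
      exact hmax' r hr

/-- Points of the level set can accumulate at `R` only if `-f R = lam`. Then `lam = -f R ≤ payoff n
R c f φR R ≤ lam`, so `R` belongs to the set. -/
theorem isCompact_levelSet_payoff {lam : ℝ} (hf : ContinuousOn f (Icc a R)) (haR : a ≤ R)
    (hle : -f R ≤ payoff n R c f φR R) (hlam : payoff n R c f φR R ≤ lam) :
    IsCompact {r | r ∈ Icc a R ∧ payoff n R c f φR r = lam} := by
  have h : {r | r ∈ Icc a R ∧ payoff n R c f φR r = lam} =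
      (Icc a R ∩ (fun r => -f r) ⁻¹' {lam}) ∪ {r | r = R ∧ payoff n R c f φR R = lam} := by
    ext r
    simp only [mem_ofPred_eq, mem_union, mem_inter_iff, mem_preimage, mem_singleton_iff]
    rcases eq_or_ne r R with rfl | hrR
    · constructor
      · exact fun h => Or.inr ⟨rfl, h.2⟩
      · rintro (h | h)
        · exact ⟨h.1, hlam.antisymm (h.2 ▸ hle)⟩
        · exact ⟨⟨haR, le_rfl⟩, h.2⟩
    · simp [payoff_of_ne hrR, hrR]
  rw [h]
  refine IsCompact.union ?_ ((finite_singleton R).subset fun r hr => hr.1).isCompact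
  exact isCompact_Icc.of_isClosed_subset
    (hf.neg.preimage_isClosed_of_isClosed isClosed_Icc isClosed_singleton) inter_subset_left

end Aubry

end RadialLevelSet

end

/-! ### Uniqueness on both intervals -/

theorem proposition4p1 (n : ℕ) (hn : 2 ≤ n) (R : ℝ) (hR : 0 < R) (c f : ℝ → ℝ) (φR : ℝ)
    (hc : ContDiffOn ℝ 1 c (Set.Icc 0 R)) (hc0 : ∀ r ∈ Set.Icc (0 : ℝ) R, 0 ≤ c r)
    (hf : ContDiffOn ℝ 1 f (Set.Icc 0 R))
    (hcoercive : RadialLevelSet.Coercive n R c) :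
    ∃ r₀ M : ℝ, IsLeast (RadialLevelSet.aubrySet n R c f φR) r₀ ∧
      IsGreatest (RadialLevelSet.aubrySet n R c f φR) M ∧
      ∀ w₁ w₂ : ℝ → ℝ,
        RadialLevelSet.IsViscositySolution n R c f φR
          (RadialLevelSet.eigenvalue n R c f φR) w₁ →
        RadialLevelSet.IsViscositySolution n R c f φR
          (RadialLevelSet.eigenvalue n R c f φR) w₂ →
        w₁ r₀ = w₂ r₀ → w₁ M = w₂ M →
        ∀ r : ℝ, (RadialLevelSet.critRadius n R c ≤ (r : EReal) ∧ r ≤ r₀) ∨ r ∈ Set.Icc M R →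
          w₁ r = w₂ r := by
  open RadialLevelSet in
  have hn1 : (2 : ℝ) ≤ n := by exact_mod_cast hn
  rcases (crossingSet n R c).eq_empty_or_nonempty with hempty | ⟨a, hacross⟩
  · have htop : critRadius n R c = ⊤ := by simp [critRadius, hempty]
    have hA : aubrySet n R c f φR = {R} := by simp [aubrySet, htop]
    refine ⟨R, R, by rw [hA]; exact isLeast_singleton, by rw [hA]; exact isGreatest_singleton, ?_⟩
    rintro w₁ w₂ - - h - r (⟨h1, -⟩ | hr)
    · rw [htop, top_le_iff] at h1
      exact absurd h1 (EReal.coe_ne_top r)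
    · rw [le_antisymm hr.2 hr.1, h]
  have hcrit := critRadius_eq hn hc hc0 hcoercive hacross
  have ha : 0 < a := hacross.1.1
  have haR : a ≤ R := hacross.1.2
  have hcr : ∀ r ∈ Set.Ioc a R, ((n : ℝ) - 1) / r < c r :=
    fun r hr => hcoercive.div_lt hn hc hc0 hacross hr
  have hmR : 0 ≤ ((n : ℝ) - 1) / R := div_nonneg (by linarith) hR.le
  have hcR : ((n : ℝ) - 1) / R ≤ c R := by
    rcases haR.eq_or_lt with rfl | h
    · exact hacross.2.ge
    · exact (hcr R ⟨h, le_rfl⟩).le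
  have hsub : Set.Icc a R ⊆ Set.Icc 0 R := Set.Icc_subset_Icc_left ha.le
  have hle : ∀ r, -f r ≤ payoff n R c f φR r := neg_le_payoff hmR hcR
  obtain ⟨t, ht, hmax⟩ := exists_isMaxOn_payoff (hf.continuousOn.mono hsub) haR (hle R)
  have hgr : IsGreatest (payoff n R c f φR '' Set.Icc a R) (payoff n R c f φR t) :=
    ⟨Set.mem_image_of_mem _ ht, by rintro _ ⟨r, hr, rfl⟩; exact hmax hr⟩
  have hlam : eigenvalue n R c f φR = payoff n R c f φR t := by
    rw [eigenvalue_eq_sSup ha haR hcrit, hgr.csSup_eq]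
  set lam := eigenvalue n R c f φR with hlamdef
  have hlam_le : ∀ r ∈ Set.Icc a R, payoff n R c f φR r ≤ lam := fun r hr => by
    rw [hlam]
    exact hmax hr
  have hA : aubrySet n R c f φR = {r | r ∈ Set.Icc a R ∧ payoff n R c f φR r = lam} :=
    aubrySet_eq ha hcrit
  have hcomp := isCompact_levelSet_payoff (hf.continuousOn.mono hsub) haR (hle R)
    (hlam_le R ⟨haR, le_rfl⟩)
  rw [← hA] at hcomp
  have hne : (aubrySet n R c f φR).Nonempty := ⟨t, by rw [hA]; exact ⟨ht, hlam.symm⟩⟩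
  obtain ⟨r₀, hr₀⟩ := hcomp.exists_isLeast hne
  obtain ⟨M, hM⟩ := hcomp.exists_isGreatest hne
  have hr₀A := hr₀.1
  have hMA := hM.1
  rw [hA] at hr₀A hMA
  have hpos : ∀ r ∈ Set.Icc a R, r ∉ aubrySet n R c f φR → 0 < lam + f r := fun r hr hrA => by
    have h1 : payoff n R c f φR r < lam :=
      (hlam_le r hr).lt_of_ne fun h => hrA (by rw [hA]; exact ⟨hr, h⟩)
    linarith [hle r]
  refine ⟨r₀, M, hr₀, hM, ?_⟩
  rintro w₁ w₂ hw₁ hw₂ h0 hM0 r (⟨har, hrr₀⟩ | hr)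
  · rw [hcrit, EReal.coe_le_coe_iff] at har
    have hs : Set.Icc a r₀ ⊆ Set.Icc 0 R := Set.Icc_subset_Icc ha.le hr₀A.1.2
    -- Positivity at `a` itself matters: it bounds `lam + f` away from `0` near `a`, where the
    -- divergence takes place.
    have hp : ∀ s ∈ Set.Ico a r₀, 0 < lam + f s := fun s hs =>
      hpos s ⟨hs.1, hs.2.le.trans hr₀A.1.2⟩ fun h => hs.2.not_ge (hr₀.2 h)
    have key : ∀ w : ℝ → ℝ, IsViscositySolution n R c f φR lam w → ∀ x y, a < x → x < y →
        y < r₀ → w y - w x = ∫ s in x..y, slopeUp n c f lam s := fun w hw x y hx hxy hy =>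
      le_antisymm (hw.sub_le_integral_slopeUp hn hc.continuousOn hf.continuousOn hc0 ha hcr
          hr₀A.1.2 (fun s hs => hp s ⟨hs.1.le, hs.2⟩) hx hxy hy)
        (hw.integral_slopeUp_le hn hc hf.continuousOn hc0 hacross hcr hr₀A.1.2 hp hx hxy hy)
    exact eqOn_Icc_of_sub_eq (hw₁.continuousOn.mono hs) (hw₂.continuousOn.mono hs)
      (fun x hx y hy hxy => (key w₁ hw₁ x y hx.1 hxy hy.2).trans
        (key w₂ hw₂ x y hx.1 hxy hy.2).symm) ⟨hr₀A.1.1, le_rfl⟩ h0 ⟨har, hrr₀⟩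
  · have hM0' : 0 < M := ha.trans_le hMA.1.1
    have hs : Set.Icc M R ⊆ Set.Icc 0 R := Set.Icc_subset_Icc_left hM0'.le
    have hp : ∀ s ∈ Set.Ioc M R, 0 < lam + f s := fun s hs =>
      hpos s ⟨hMA.1.1.trans hs.1.le, hs.2⟩ fun h => hs.1.not_ge (hM.2 h)
    have hcr' : ∀ s ∈ Set.Ioc M R, ((n : ℝ) - 1) / s < c s := fun s hs =>
      hcr s ⟨hMA.1.1.trans_lt hs.1, hs.2⟩
    have key : ∀ w : ℝ → ℝ, IsViscositySolution n R c f φR lam w → ∀ x y, M < x → x < y →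
        y < R → w y - w x = -∫ s in x..y, slopeDown n c f lam s := by
      intro w hw x y hx hxy hy
      have hMR : M < R := hx.trans (hxy.trans hy)
      -- Since `M < R`, the point `R` is not in the Aubry set, so its payoff is strictly below
      -- `lam`.
      have hφ : φR < slopeUp n c f lam R := by
        refine lt_slopeUp_of_payoff_lt hmR (hcr' R ⟨hMR, le_rfl⟩) ?_
        refine (hlam_le R ⟨haR, le_rfl⟩).lt_of_ne fun h => hMR.not_ge (hM.2 ?_)
        rw [hA]
        exact ⟨⟨haR, le_rfl⟩, h⟩
      exact le_antisymm
        (hw.sub_le_neg_integral_slopeDown hn hc.continuousOn hf.continuousOn hc0 hM0' hcr' hp hφ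
          hx hxy hy)
        (hw.neg_integral_slopeDown_le hc.continuousOn hf.continuousOn hM0' hcr' le_rfl
          (fun s hs => hp s ⟨hs.1, hs.2.le⟩) hx hxy hy)
    exact eqOn_Icc_of_sub_eq (hw₁.continuousOn.mono hs) (hw₂.continuousOn.mono hs)
      (fun x hx y hy hxy => (key w₁ hw₁ x y hx.1 hxy hy.2).trans
        (key w₂ hw₂ x y hx.1 hxy hy.2).symm) ⟨le_rfl, hMA.1.2⟩ hM0 hr
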